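/- For an integer $n\ge 1$ let $\mathcal T_n$ be the set of all functions $f:\mathbb R\to\mathbb C$ of the form $$f(t)=\sum_{j=1}^n a_j e^{i\lambda_j t},\qquad a_j\in\mathbb C,\quad \lambda_1<\lambda_2<\cdots<\lambda_n \text{ real}.$$ Write $\|f\|_{[0,1]}=\sup_{t\in[0,1]}|f(t)|$, $\|f\|_{L_q[0,1]}=\left(\int_0^1|f(t)|^q\,dt\right)^{1/q}$ for $0<q<\infty$, and let $\|f\|_{L_\infty[0,1]}$ be the essential supremum of $|f|$ on $[0,1]$. Then for every $n\ge 1$ and every $f\in\mathcal T_n$: (i) $\displaystyle \|f\|_{[0,1]}\le \frac{\pi n}{2}\,\|f\|_{L_2[0,1]}$; (ii) $\displaystyle \|f\|_{[0,1]}\le \left(\frac{\pi n}{2}\right)^{2/q}\|f\|_{L_q[0,1]}$ for all $0<q\le 2$; (iii) $\displaystyle \|f\|_{L_p[0,1]}\le \left(\frac{\pi n}{2}\right)^{2/q-2/p}\|f\|_{L_q[0,1]}$ for all $0<q<p\le\infty$ with $q\le 2$, where $2/p=0$ if $p=\infty$. -/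

import Mathlib

open MeasureTheory
open scoped ENNReal

/-- The class `𝒯ₙ` of exponential sums `t ↦ ∑ⱼ aⱼ e^{i λⱼ t}` with `n` terms, complex coefficients
`aⱼ` (some of which may vanish) and real frequencies `λ₁ < λ₂ < ⋯ < λₙ`. -/
def ExpSums (n : ℕ) : Set (ℝ → ℂ) :=
  {f | ∃ (a : Fin n → ℂ) (lam : Fin n → ℝ), StrictMono lam ∧
    ∀ t : ℝ, f t = ∑ j, a j * Complex.exp (Complex.I * (lam j : ℂ) * (t : ℂ))}

/-- The uniform norm `‖f‖_A = sup_{t ∈ A} |f(t)|`, as an extended nonnegative real. -/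
noncomputable def supNormOn (A : Set ℝ) (f : ℝ → ℂ) : ℝ≥0∞ :=
  ⨆ t ∈ A, ‖f t‖ₑ

/-- The norm (quasi-norm, for `q < 1`) of `L_q[0,1]` for Lebesgue measure: `(∫₀¹ |f|^q)^{1/q}`
for `0 < q < ∞`, the essential supremum over `[0,1]` for `q = ∞`; as an extended nonnegative
real. -/
noncomputable def lqNormUnit (q : ℝ≥0∞) (f : ℝ → ℂ) : ℝ≥0∞ :=
  eLpNorm f q (volume.restrict (Set.Icc (0 : ℝ) 1))

/-! Fix `N` and put `L = n * N`. Along the grid `k / L` an exponential sum is a combination of `n`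
geometric progressions `z j ^ k` with `‖z j‖ = 1`, so any polynomial `P` vanishing at the `z j`
gives the recurrence `∑ P.coeff k * f (k / L) = 0`, which expresses `f 0` through the other samples.
By Cauchy–Schwarz, the bound is good when `P.coeff 0` carries almost all the `ℓ²` mass of the
coefficients. If `‖P‖ ≤ 1` on the unit circle, Parseval bounds that mass by `1`. A product of `n`
rotated copies of a polynomial built from `N` plane rotations of angle `π / (2N)` has constant term
`cos (π / (2N)) ^ L`, leaving at most `n π² / (4N) = (π n / 2)² / L` for the rest
(`endpoint_discrete`). As `N → ∞` the samples form a Riemann integral (`endpoint_bound`). Rescaling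
moves the endpoint estimate to any point of `[0,1]` (`pointwise_bound`); interpolating `L_q` with
the uniform norm gives the other exponents. -/

/-- The polynomial pair `(A, B)` generated from `(1, 0)` by `N` steps, each multiplying `B` by `X`
and then rotating `(A, B)` by the angle `η`. -/
noncomputable def rotationPair (η : ℝ) : ℕ → Polynomial ℂ × Polynomial ℂ
  | 0 => (1, 0)
  | k + 1 =>
    (Polynomial.C (Real.cos η : ℂ) * (rotationPair η k).1
        - Polynomial.C (Real.sin η : ℂ) * (Polynomial.X * (rotationPair η k).2),
      Polynomial.C (Real.sin η : ℂ) * (rotationPair η k).1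
        + Polynomial.C (Real.cos η : ℂ) * (Polynomial.X * (rotationPair η k).2))

theorem rotationPair_natDegree_le (η : ℝ) (k : ℕ) :
    (rotationPair η k).1.natDegree ≤ k ∧ (rotationPair η k).2.natDegree ≤ k := by
  induction k with
  | zero => simp [rotationPair]
  | succ k ih =>
    have hX : (Polynomial.X * (rotationPair η k).2).natDegree ≤ k + 1 :=
      Polynomial.natDegree_mul_le.trans (by
        rw [Polynomial.natDegree_X, add_comm]; exact Nat.add_le_add_right ih.2 1)
    have hA : (rotationPair η k).1.natDegree ≤ k + 1 := ih.1.trans k.le_succ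
    exact ⟨(Polynomial.natDegree_sub_le_of_le ((Polynomial.natDegree_C_mul_le _ _).trans hA)
        ((Polynomial.natDegree_C_mul_le _ _).trans hX)).trans_eq (max_self _),
      (Polynomial.natDegree_add_le_of_le ((Polynomial.natDegree_C_mul_le _ _).trans hA)
        ((Polynomial.natDegree_C_mul_le _ _).trans hX)).trans_eq (max_self _)⟩

theorem rotationPair_eval_zero (η : ℝ) (k : ℕ) :
    (rotationPair η k).1.eval 0 = (Real.cos η : ℂ) ^ k := by
  induction k with
  | zero => simp [rotationPair]
  | succ k ih => simp only [rotationPair, Polynomial.eval_sub, Polynomial.eval_mul,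
      Polynomial.eval_C, Polynomial.eval_X, ih]; ring

/-- At `1` the multiplication by `X` does nothing, so the `k` rotations compose to a single one of
angle `k * η`. -/
theorem rotationPair_eval_one (η : ℝ) (k : ℕ) :
    (rotationPair η k).1.eval 1 = (Real.cos (k * η) : ℂ) ∧
      (rotationPair η k).2.eval 1 = (Real.sin (k * η) : ℂ) := by
  induction k with
  | zero => simp [rotationPair]
  | succ k ih =>
    have h : ((k + 1 : ℕ) : ℝ) * η = k * η + η := by push_cast; ring
    constructor
    · rw [h, Real.cos_add]
      simp only [rotationPair, Polynomial.eval_sub, Polynomial.eval_mul,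
        Polynomial.eval_C, Polynomial.eval_X, ih]
      push_cast; ring
    · rw [h, Real.sin_add]
      simp only [rotationPair, Polynomial.eval_add, Polynomial.eval_mul,
        Polynomial.eval_C, Polynomial.eval_X, ih]
      push_cast; ring

theorem normSq_rotation (η : ℝ) (u v : ℂ) :
    Complex.normSq ((Real.cos η : ℂ) * u - (Real.sin η : ℂ) * v)
      + Complex.normSq ((Real.sin η : ℂ) * u + (Real.cos η : ℂ) * v)
      = Complex.normSq u + Complex.normSq v := by
  simp only [Complex.normSq_apply, Complex.sub_re, Complex.sub_im, Complex.add_re, Complex.add_im,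
    Complex.re_ofReal_mul, Complex.im_ofReal_mul]
  linear_combination (u.re ^ 2 + u.im ^ 2 + v.re ^ 2 + v.im ^ 2) * Real.sin_sq_add_cos_sq η

/-- Each step is a multiplication by a unimodular number followed by a rotation, and both preserve
the sum of squares. -/
theorem normSq_rotationPair_eval (η : ℝ) (k : ℕ) {z : ℂ} (hz : ‖z‖ = 1) :
    Complex.normSq ((rotationPair η k).1.eval z)
      + Complex.normSq ((rotationPair η k).2.eval z) = 1 := by
  induction k with
  | zero => simp [rotationPair]
  | succ k ih =>
    simp only [rotationPair, Polynomial.eval_add, Polynomial.eval_sub, Polynomial.eval_mul,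
      Polynomial.eval_C, Polynomial.eval_X]
    rw [normSq_rotation, Complex.normSq_mul, Complex.normSq_eq_norm_sq z, hz]
    simpa using ih

theorem norm_rotationPair_eval_le (η : ℝ) (k : ℕ) {z : ℂ} (hz : ‖z‖ = 1) :
    ‖(rotationPair η k).1.eval z‖ ≤ 1 := by
  have h := normSq_rotationPair_eval η k hz
  have h2 := Complex.normSq_nonneg ((rotationPair η k).2.eval z)
  rw [Complex.normSq_eq_norm_sq] at h
  nlinarith [norm_nonneg ((rotationPair η k).1.eval z)]

/-- A polynomial of degree at most `n * N` vanishing at `n` prescribed points of the unit circle,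
bounded by `1` on the circle, with a constant coefficient close to `1`. -/
theorem exists_polynomial_vanishing (n N : ℕ) (hN : N ≠ 0) (z : Fin n → ℂ) (hz : ∀ j, ‖z j‖ = 1) :
    ∃ P : Polynomial ℂ, P.natDegree ≤ n * N ∧ (∀ j, P.eval (z j) = 0) ∧
      P.coeff 0 = (Real.cos (Real.pi / (2 * N)) : ℂ) ^ (n * N) ∧
      ∀ w : ℂ, ‖w‖ = 1 → ‖P.eval w‖ ≤ 1 := by
  set η := Real.pi / (2 * N) with hη
  set A := (rotationPair η N).1 with hA
  -- `A` vanishes at `1`, so the `j`-th factor `A (X / z j)` vanishes at `z j`.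
  refine ⟨∏ j, A.comp (Polynomial.C (z j)⁻¹ * Polynomial.X), ?_, ?_, ?_, ?_⟩
  · refine (Polynomial.natDegree_prod_le _ _).trans ?_
    refine (Finset.sum_le_card_nsmul _ _ N fun j _ => ?_).trans (by simp)
    refine Polynomial.natDegree_comp_le.trans ?_
    calc A.natDegree * (Polynomial.C (z j)⁻¹ * Polynomial.X).natDegree
        ≤ N * 1 := Nat.mul_le_mul (rotationPair_natDegree_le η N).1
          ((Polynomial.natDegree_C_mul_le _ _).trans Polynomial.natDegree_X_le)
      _ = N := mul_one N
  · intro j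
    rw [Polynomial.eval_prod]
    refine Finset.prod_eq_zero (Finset.mem_univ j) ?_
    have hzj : z j ≠ 0 := fun h => by simpa [h] using hz j
    have hNη : N * η = Real.pi / 2 := by
      rw [hη]; field_simp
    simp [Polynomial.eval_comp, inv_mul_cancel₀ hzj, hA, (rotationPair_eval_one η N).1,
      -Complex.ofReal_cos, hNη]
  · rw [Polynomial.coeff_zero_eq_eval_zero, Polynomial.eval_prod]
    simp only [Polynomial.eval_comp, Polynomial.eval_mul, Polynomial.eval_C, Polynomial.eval_X,
      mul_zero, hA, rotationPair_eval_zero, Finset.prod_const, Finset.card_univ, Fintype.card_fin]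
    rw [← pow_mul, mul_comm N n]
  · intro w hw
    rw [Polynomial.eval_prod, norm_prod]
    refine Finset.prod_le_one (fun _ _ => norm_nonneg _) fun j _ => ?_
    rw [Polynomial.eval_comp]
    exact norm_rotationPair_eval_le η N (by simp [hz, hw])

/-- Parseval: the sum is the mean of `‖P‖ ^ 2` over the unit circle. -/
theorem Polynomial.sum_sq_norm_coeff_le_one {P : Polynomial ℂ} {L : ℕ} (hL : P.natDegree ≤ L)
    (hP : ∀ w : ℂ, ‖w‖ = 1 → ‖P.eval w‖ ≤ 1) :
    ∑ k ∈ Finset.range (L + 1), ‖P.coeff k‖ ^ 2 ≤ 1 := by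
  have h : ∑ k ∈ Finset.range (L + 1), ‖P.coeff k‖ ^ 2 = ∑ k ∈ P.support, ‖P.coeff k‖ ^ 2 := by
    symm
    refine Finset.sum_subset (fun k hk => ?_) (fun k _ hk => by simpa using hk)
    exact Finset.mem_range.2
      (Nat.lt_succ_of_le ((Polynomial.le_natDegree_of_mem_supp k hk).trans hL))
  rw [h, Polynomial.sum_sq_norm_coeff_eq_circleAverage]
  refine Real.circleAverage_mono_on_of_le_circle ?_ fun w hw => ?_
  · exact (Continuous.continuousOn (by fun_prop)).circleIntegrable'
  · have := hP w (by simpa using hw)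
    simpa using this

/-! ### The inequality at an endpoint -/

/-- A discrete form of the `L₂` bound at the endpoint `0`, with samples at the points
`k / (n * N)`. -/
theorem endpoint_discrete {n N : ℕ} (hN : N ≠ 0) (hn : n ≠ 0) (a : Fin n → ℂ) (lam : Fin n → ℝ)
    {f : ℝ → ℂ} (hf : ∀ t : ℝ, f t = ∑ j, a j * Complex.exp (Complex.I * (lam j : ℂ) * (t : ℂ))) :
    (1 - n * Real.pi ^ 2 / (4 * N)) * ‖f 0‖ ^ 2 ≤
      (Real.pi * n / 2) ^ 2 * ((1 / (n * N : ℕ) : ℝ) *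
        ∑ k ∈ Finset.range (n * N), ‖f ((k + 1 : ℕ) / (n * N : ℕ))‖ ^ 2) := by
  set L := n * N with hLdef
  have hL : (L : ℝ) ≠ 0 := by simp [hLdef, hn, hN]
  set z : Fin n → ℂ := fun j => Complex.exp (Complex.I * (lam j : ℂ) * ((1 / L : ℝ) : ℂ)) with hz
  have hz1 : ∀ j, ‖z j‖ = 1 := fun j => by
    rw [hz]
    simp only
    rw [show Complex.I * (lam j : ℂ) * ((1 / L : ℝ) : ℂ)
      = ((lam j * (1 / L) : ℝ) : ℂ) * Complex.I by push_cast; ring]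
    exact Complex.norm_exp_ofReal_mul_I _
  obtain ⟨P, hdeg, hroot, hP0, hPle⟩ := exists_polynomial_vanishing n N hN z hz1
  have hsum := Polynomial.sum_sq_norm_coeff_le_one hdeg hPle
  have hfk : ∀ k : ℕ, f (k / L) = ∑ j, a j * z j ^ k := fun k => by
    rw [hf]
    refine Finset.sum_congr rfl fun j _ => ?_
    rw [hz]
    simp only
    rw [← Complex.exp_nat_mul]
    congr 2
    push_cast; ring
  have hrec : ∑ k ∈ Finset.range (L + 1), P.coeff k * f (k / L) = 0 := by
    simp_rw [hfk, Finset.mul_sum]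
    rw [Finset.sum_comm]
    refine Finset.sum_eq_zero fun j _ => ?_
    have := hroot j
    rw [Polynomial.eval_eq_sum_range' (Nat.lt_succ_of_le hdeg)] at this
    calc ∑ k ∈ Finset.range (L + 1), P.coeff k * (a j * z j ^ k)
        = a j * ∑ k ∈ Finset.range (L + 1), P.coeff k * z j ^ k := by
          rw [Finset.mul_sum]; exact Finset.sum_congr rfl fun k _ => by ring
      _ = 0 := by rw [this, mul_zero]
  rw [Finset.sum_range_succ'] at hsum hrec
  set c := Real.cos (Real.pi / (2 * N)) with hc
  set S := ∑ k ∈ Finset.range L, ‖P.coeff (k + 1)‖ ^ 2 with hS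
  set F := ∑ k ∈ Finset.range L, ‖f ((k + 1 : ℕ) / L)‖ ^ 2 with hF
  have hP0n : ‖P.coeff 0‖ ^ 2 = (c ^ 2) ^ L := by
    rw [hP0, norm_pow, Complex.norm_real, ← pow_mul, mul_comm, pow_mul, Real.norm_eq_abs, sq_abs]
  have hcs : ‖P.coeff 0‖ ^ 2 * ‖f 0‖ ^ 2 ≤ S * F := by
    have h1 : P.coeff 0 * f 0 = -∑ k ∈ Finset.range L, P.coeff (k + 1) * f ((k + 1 : ℕ) / L) := by
      rw [eq_neg_iff_add_eq_zero, add_comm]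
      simpa using hrec
    rw [← mul_pow, ← norm_mul, h1, norm_neg]
    calc _ ≤ (∑ k ∈ Finset.range L, ‖P.coeff (k + 1)‖ * ‖f ((k + 1 : ℕ) / L)‖) ^ 2 := by
          gcongr
          refine (norm_sum_le _ _).trans_eq (by simp)
      _ ≤ _ := Finset.sum_mul_sq_le_sq_mul_sq _ _ _
  -- Bernoulli's inequality for `(1 - sin²) ^ L`, together with `|sin x| ≤ |x|`.
  have hbern : 1 - n * Real.pi ^ 2 / (4 * N) ≤ (c ^ 2) ^ L := by
    have hs : Real.sin (Real.pi / (2 * N)) ^ 2 ≤ (Real.pi / (2 * N)) ^ 2 :=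
      sq_le_sq.2 Real.abs_sin_le_abs
    have h2 := one_add_mul_le_pow (a := -Real.sin (Real.pi / (2 * N)) ^ 2)
      (by nlinarith [Real.sin_sq_le_one (Real.pi / (2 * N))]) L
    have h3 : c ^ 2 = 1 + -Real.sin (Real.pi / (2 * N)) ^ 2 := by
      rw [hc, Real.cos_sq']; ring
    rw [h3]
    refine le_trans ?_ h2
    have h4 : n * Real.pi ^ 2 / (4 * N) = L * (Real.pi / (2 * N)) ^ 2 := by
      rw [hLdef]; push_cast; field_simp; ring
    rw [h4]
    nlinarith [mul_le_mul_of_nonneg_left hs (Nat.cast_nonneg (α := ℝ) L)]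
  -- Parseval leaves to the other coefficients at most `1 - ‖P.coeff 0‖ ^ 2`.
  have hSle : S ≤ n * Real.pi ^ 2 / (4 * N) := by linarith
  have hF0 : 0 ≤ F := Finset.sum_nonneg fun _ _ => by positivity
  calc (1 - n * Real.pi ^ 2 / (4 * N)) * ‖f 0‖ ^ 2
      ≤ ‖P.coeff 0‖ ^ 2 * ‖f 0‖ ^ 2 := by rw [hP0n]; gcongr
    _ ≤ S * F := hcs
    _ ≤ n * Real.pi ^ 2 / (4 * N) * F := by gcongr
    _ = _ := by rw [hLdef]; push_cast; field_simp; ring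

theorem tendsto_riemannSum {g : ℝ → ℝ} (hg : Continuous g) :
    Filter.Tendsto (fun L : ℕ => (1 / L : ℝ) * ∑ k ∈ Finset.range L, g ((k + 1 : ℕ) / L))
      Filter.atTop (nhds (∫ t in (0 : ℝ)..1, g t)) := by
  rw [Metric.tendsto_atTop]
  intro ε hε
  obtain ⟨δ, hδ, hgδ⟩ := Metric.uniformContinuousOn_iff.1
    ((isCompact_Icc (a := (0 : ℝ)) (b := 1)).uniformContinuousOn_of_continuous hg.continuousOn)
    (ε / 2) (half_pos hε)
  obtain ⟨M, hM⟩ := exists_nat_gt (1 / δ)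
  refine ⟨M, fun L hL => ?_⟩
  have hML : 1 / δ < L := hM.trans_le (by exact_mod_cast hL)
  have hL0 : (0 : ℝ) < L := (by positivity : 0 < 1 / δ).trans hML
  have hLδ : 1 / (L : ℝ) < δ := by
    rw [div_lt_iff₀ hL0]; rw [div_lt_iff₀ hδ] at hML; linarith
  have hsplit : ∫ t in (0 : ℝ)..1, g t =
      ∑ k ∈ Finset.range L, ∫ t in ((k : ℕ) / L : ℝ)..((k + 1 : ℕ) / L : ℝ), g t := by
    rw [intervalIntegral.sum_integral_adjacent_intervals (a := fun k : ℕ => (k / L : ℝ))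
      fun k _ => hg.intervalIntegrable _ _]
    simp [hL0.ne']
  have hlen : ∀ k : ℕ, ((k + 1 : ℕ) / L : ℝ) - (k : ℕ) / L = 1 / L := fun k => by
    push_cast; ring
  have hterm : ∀ k ∈ Finset.range L,
      ‖1 / (L : ℝ) * g ((k + 1 : ℕ) / L) - ∫ t in ((k : ℕ) / L : ℝ)..((k + 1 : ℕ) / L : ℝ), g t‖
        ≤ ε / 2 * (1 / L) := by
    intro k hk
    have hk1 : ((k + 1 : ℕ) : ℝ) ≤ L := by exact_mod_cast Finset.mem_range.1 hk
    have hconst : 1 / (L : ℝ) * g ((k + 1 : ℕ) / L)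
        = ∫ t in ((k : ℕ) / L : ℝ)..((k + 1 : ℕ) / L : ℝ), g ((k + 1 : ℕ) / L) := by
      rw [intervalIntegral.integral_const, hlen, smul_eq_mul]
    rw [hconst, ← intervalIntegral.integral_sub (by simp) (hg.intervalIntegrable _ _)]
    have hlek : ((k : ℕ) / L : ℝ) ≤ ((k + 1 : ℕ) / L : ℝ) := by
      have := hlen k
      have : 0 < 1 / (L : ℝ) := by positivity
      linarith
    refine (intervalIntegral.norm_integral_le_of_norm_le_const (C := ε / 2) fun t ht => ?_).trans_eq
      (by rw [hlen, abs_of_pos (by positivity)])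
    rw [Set.uIoc_of_le hlek] at ht
    have hk0 : (0 : ℝ) ≤ (k : ℕ) / L := by positivity
    have hup : ((k + 1 : ℕ) / L : ℝ) ≤ 1 := by rw [div_le_one hL0]; exact hk1
    have hd := hlen k
    refine (hgδ _ ⟨by linarith, hup⟩ t ⟨by linarith [ht.1], ht.2.trans hup⟩ ?_).le
    rw [Real.dist_eq, abs_of_nonneg (by linarith [ht.2])]
    linarith [ht.1]
  rw [hsplit, Finset.mul_sum, dist_eq_norm, ← Finset.sum_sub_distrib]
  calc _ ≤ ∑ _k ∈ Finset.range L, ε / 2 * (1 / L) := norm_sum_le_of_le _ hterm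
    _ = ε / 2 := by simp; field_simp
    _ < ε := half_lt_self hε

theorem continuous_expSum {n : ℕ} (a : Fin n → ℂ) (lam : Fin n → ℝ)
    {f : ℝ → ℂ} (hf : ∀ t : ℝ, f t = ∑ j, a j * Complex.exp (Complex.I * (lam j : ℂ) * (t : ℂ))) :
    Continuous f := by
  rw [funext hf]
  fun_prop

theorem endpoint_bound {n : ℕ} (hn : n ≠ 0) (a : Fin n → ℂ) (lam : Fin n → ℝ)
    {f : ℝ → ℂ} (hf : ∀ t : ℝ, f t = ∑ j, a j * Complex.exp (Complex.I * (lam j : ℂ) * (t : ℂ))) :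
    ‖f 0‖ ^ 2 ≤ (Real.pi * n / 2) ^ 2 * ∫ t in (0 : ℝ)..1, ‖f t‖ ^ 2 := by
  have hcont := continuous_expSum a lam hf
  have hmul : Filter.Tendsto (fun N : ℕ => n * N) Filter.atTop Filter.atTop :=
    Filter.tendsto_id.const_mul_atTop' (Nat.pos_of_ne_zero hn)
  have h1 := ((tendsto_riemannSum (g := fun t => ‖f t‖ ^ 2) (by fun_prop)).comp hmul).const_mul
    ((Real.pi * n / 2) ^ 2)
  have h2 : Filter.Tendsto (fun N : ℕ => (1 - n * Real.pi ^ 2 / (4 * (N : ℝ))) * ‖f 0‖ ^ 2)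
      Filter.atTop (nhds ((1 - 0) * ‖f 0‖ ^ 2)) := by
    refine (tendsto_const_nhds.sub ?_).mul_const _
    exact tendsto_const_nhds.div_atTop
      (tendsto_natCast_atTop_atTop.const_mul_atTop (by norm_num : (0 : ℝ) < 4))
  have h3 := le_of_tendsto_of_tendsto h2 h1 (by
    filter_upwards [Filter.eventually_ne_atTop 0] with N hN
    exact endpoint_discrete hN hn a lam hf)
  simpa using h3

/-- An affine substitution only changes coefficients and frequencies. The order of the frequencies
plays no role, so `s` may be negative, which covers intervals to the left of `y`. -/
theorem scaled_endpoint_bound {n : ℕ} (hn : n ≠ 0) (a : Fin n → ℂ) (lam : Fin n → ℝ)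
    {f : ℝ → ℂ} (hf : ∀ t : ℝ, f t = ∑ j, a j * Complex.exp (Complex.I * (lam j : ℂ) * (t : ℂ)))
    (y s : ℝ) :
    ‖f y‖ ^ 2 ≤ (Real.pi * n / 2) ^ 2 * ∫ t in (0 : ℝ)..1, ‖f (y + s * t)‖ ^ 2 := by
  have := endpoint_bound hn (fun j => a j * Complex.exp (Complex.I * (lam j : ℂ) * (y : ℂ)))
    (fun j => lam j * s) (f := fun t => f (y + s * t)) (fun t => by
      rw [hf]
      refine Finset.sum_congr rfl fun j _ => ?_
      rw [mul_assoc (a j), ← Complex.exp_add]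
      congr 2
      push_cast; ring)
  simpa using this

/-- Average the endpoint estimates on `[y, 1]` and `[0, y]` with weights `1 - y` and `y`: these
cancel the Jacobians, and the two integrals add up to the one over `[0, 1]` with no loss in the
constant. -/
theorem pointwise_bound {n : ℕ} (a : Fin n → ℂ) (lam : Fin n → ℝ)
    {f : ℝ → ℂ} (hf : ∀ t : ℝ, f t = ∑ j, a j * Complex.exp (Complex.I * (lam j : ℂ) * (t : ℂ)))
    {y : ℝ} (hy : y ∈ Set.Icc (0 : ℝ) 1) :
    ‖f y‖ ^ 2 ≤ (Real.pi * n / 2) ^ 2 * ∫ t in (0 : ℝ)..1, ‖f t‖ ^ 2 := by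
  rcases eq_or_ne n 0 with rfl | hn
  · simp [hf]
  have hcont := continuous_expSum a lam hf
  set g : ℝ → ℝ := fun t => ‖f t‖ ^ 2 with hg
  have hI : ∀ u v : ℝ, IntervalIntegrable g volume u v := fun u v =>
    (by fun_prop : Continuous g).intervalIntegrable u v
  have h1 := mul_le_mul_of_nonneg_left (scaled_endpoint_bound hn a lam hf y (1 - y))
    (sub_nonneg.2 hy.2)
  have h2 := mul_le_mul_of_nonneg_left (scaled_endpoint_bound hn a lam hf y (-y)) hy.1
  have e1 : (1 - y) * ∫ t in (0 : ℝ)..1, ‖f (y + (1 - y) * t)‖ ^ 2 = ∫ t in y..1, g t := by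
    simpa [hg] using intervalIntegral.mul_integral_comp_add_mul (a := 0) (b := 1) (f := g) (1 - y) y
  have e2 : -y * ∫ t in (0 : ℝ)..1, ‖f (y + -y * t)‖ ^ 2 = ∫ t in y..0, g t := by
    simpa [hg] using intervalIntegral.mul_integral_comp_add_mul (a := 0) (b := 1) (f := g) (-y) y
  have e3 := intervalIntegral.integral_add_adjacent_intervals (hI 0 y) (hI y 1)
  have e4 := intervalIntegral.integral_symm (f := g) (μ := volume) 0 y
  rw [← e3]
  linear_combination h1 + h2 + (Real.pi * n / 2) ^ 2 * (e1 - e2 - e4)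

/-! ### Passage to other exponents -/

theorem lqNormUnit_ofReal {q : ℝ} (hq : 0 < q) (f : ℝ → ℂ) :
    lqNormUnit (ENNReal.ofReal q) f
      = (∫⁻ t in Set.Icc (0 : ℝ) 1, ‖f t‖ₑ ^ q) ^ (1 / q) := by
  rw [lqNormUnit, eLpNorm_eq_lintegral_rpow_enorm_toReal (by simpa using hq) ENNReal.ofReal_ne_top,
    ENNReal.toReal_ofReal hq.le]

theorem lqNormUnit_ofReal_rpow {q : ℝ} (hq : 0 < q) (f : ℝ → ℂ) :
    lqNormUnit (ENNReal.ofReal q) f ^ q = ∫⁻ t in Set.Icc (0 : ℝ) 1, ‖f t‖ₑ ^ q := by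
  rw [lqNormUnit_ofReal hq, ← ENNReal.rpow_mul, one_div_mul_cancel hq.ne', ENNReal.rpow_one]

theorem enorm_le_supNormOn {A : Set ℝ} (f : ℝ → ℂ) {t : ℝ} (ht : t ∈ A) :
    ‖f t‖ₑ ≤ supNormOn A f :=
  le_iSup₂ (f := fun t (_ : t ∈ A) => ‖f t‖ₑ) t ht

theorem supNormOn_ne_top {A : Set ℝ} (hA : IsCompact A) {f : ℝ → ℂ} (hf : Continuous f) :
    supNormOn A f ≠ ∞ := by
  obtain ⟨C, hC⟩ := hA.exists_bound_of_continuousOn hf.continuousOn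
  refine ne_top_of_le_ne_top (ENNReal.ofReal_ne_top (r := C)) (iSup₂_le fun t ht => ?_)
  rw [← ofReal_norm]
  exact ENNReal.ofReal_le_ofReal (hC t ht)

theorem lqNormUnit_top_le_supNormOn (f : ℝ → ℂ) :
    lqNormUnit ∞ f ≤ supNormOn (Set.Icc 0 1) f := by
  rw [lqNormUnit, eLpNorm_exponent_top]
  exact essSup_le_of_ae_le _ ((ae_restrict_mem measurableSet_Icc).mono
    fun t ht => enorm_le_supNormOn f ht)

/-- Interpolation between `L_q` and the uniform norm. -/
theorem lqNormUnit_rpow_le {p q : ℝ} (hq : 0 < q) (hqp : q ≤ p) {f : ℝ → ℂ} (hf : Continuous f) :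
    lqNormUnit (ENNReal.ofReal p) f ^ p ≤
      supNormOn (Set.Icc 0 1) f ^ (p - q) * lqNormUnit (ENNReal.ofReal q) f ^ q := by
  rw [lqNormUnit_ofReal_rpow (hq.trans_le hqp), lqNormUnit_ofReal_rpow hq,
    ← lintegral_const_mul _ (by fun_prop)]
  refine setLIntegral_mono' measurableSet_Icc fun t ht => ?_
  calc ‖f t‖ₑ ^ p = ‖f t‖ₑ ^ (p - q) * ‖f t‖ₑ ^ q := by
        rw [← ENNReal.rpow_add_of_nonneg _ _ (sub_nonneg.2 hqp) hq.le, sub_add_cancel]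
    _ ≤ _ := by
        gcongr
        exact enorm_le_supNormOn f ht

theorem supNormOn_le_lqNormUnit_two {n : ℕ} (a : Fin n → ℂ) (lam : Fin n → ℝ)
    {f : ℝ → ℂ} (hf : ∀ t : ℝ, f t = ∑ j, a j * Complex.exp (Complex.I * (lam j : ℂ) * (t : ℂ))) :
    supNormOn (Set.Icc (0 : ℝ) 1) f ≤
      ENNReal.ofReal (Real.pi * (n : ℝ) / 2) * lqNormUnit (ENNReal.ofReal 2) f := by
  have hcont := continuous_expSum a lam hf
  refine iSup₂_le fun y hy => ?_
  have hc : 0 ≤ Real.pi * (n : ℝ) / 2 := by positivity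
  have hint : ENNReal.ofReal (∫ t in (0 : ℝ)..1, ‖f t‖ ^ 2)
      = lqNormUnit (ENNReal.ofReal 2) f ^ (2 : ℝ) := by
    rw [lqNormUnit_ofReal_rpow two_pos, intervalIntegral.integral_of_le zero_le_one,
      ← integral_Icc_eq_integral_Ioc, ofReal_integral_eq_lintegral_ofReal
        (by fun_prop : Continuous fun t => ‖f t‖ ^ 2).integrableOn_Icc
        (Filter.Eventually.of_forall fun t => by positivity)]
    refine lintegral_congr fun t => ?_
    rw [ENNReal.ofReal_pow (norm_nonneg _), ofReal_norm, ENNReal.rpow_two]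
  have h := ENNReal.ofReal_le_ofReal (pointwise_bound a lam hf hy)
  rw [ENNReal.ofReal_mul (by positivity), hint, ENNReal.ofReal_pow (norm_nonneg _), ofReal_norm,
    ENNReal.ofReal_pow hc, ← ENNReal.rpow_two, ← ENNReal.rpow_two,
    ← ENNReal.mul_rpow_of_nonneg _ _ zero_le_two] at h
  exact (ENNReal.rpow_le_rpow_iff two_pos).1 h

/-- A Nikolskii inequality between the uniform norm and `L₂` self-improves to `L_q`, `q ≤ 2`. -/
theorem supNormOn_le_of_le_two {C : ℝ≥0∞} {f : ℝ → ℂ} (hf : Continuous f)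
    (h2 : supNormOn (Set.Icc (0 : ℝ) 1) f ≤ C * lqNormUnit (ENNReal.ofReal 2) f)
    {q : ℝ} (hq : 0 < q) (hq2 : q ≤ 2) :
    supNormOn (Set.Icc (0 : ℝ) 1) f ≤ C ^ (2 / q) * lqNormUnit (ENNReal.ofReal q) f := by
  set S := supNormOn (Set.Icc (0 : ℝ) 1) f with hS
  rcases eq_or_ne S 0 with h0 | h0
  · simp [h0]
  have hT : S ≠ ∞ := supNormOn_ne_top isCompact_Icc hf
  have h : S ^ (2 - q) * S ^ q ≤
      S ^ (2 - q) * (C ^ (2 : ℝ) * lqNormUnit (ENNReal.ofReal q) f ^ q) := by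
    calc S ^ (2 - q) * S ^ q = S ^ (2 : ℝ) := by
          rw [← ENNReal.rpow_add_of_nonneg _ _ (sub_nonneg.2 hq2) hq.le, sub_add_cancel]
      _ ≤ (C * lqNormUnit (ENNReal.ofReal 2) f) ^ (2 : ℝ) := by gcongr
      _ = C ^ (2 : ℝ) * lqNormUnit (ENNReal.ofReal 2) f ^ (2 : ℝ) :=
          ENNReal.mul_rpow_of_nonneg _ _ zero_le_two
      _ ≤ C ^ (2 : ℝ) * (S ^ (2 - q) * lqNormUnit (ENNReal.ofReal q) f ^ q) := by
          gcongr
          exact lqNormUnit_rpow_le hq hq2 hf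
      _ = _ := by ring
  -- Cancelling `S ^ (2 - q)` is legitimate because `0 < S < ∞`; finiteness comes from continuity on
  -- a compact interval.
  rw [ENNReal.mul_le_mul_iff_right (by simp [h0, hT]) (by simp [h0, hT])] at h
  refine (ENNReal.rpow_le_rpow_iff hq).1 (h.trans_eq ?_)
  rw [ENNReal.mul_rpow_of_nonneg _ _ hq.le, ← ENNReal.rpow_mul, div_mul_cancel₀ _ hq.ne']

theorem lqNormUnit_le_of_supNormOn_le {C : ℝ≥0∞} {f : ℝ → ℂ} (hf : Continuous f)
    {p q : ℝ} (hq : 0 < q) (hqp : q < p)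
    (h : supNormOn (Set.Icc (0 : ℝ) 1) f ≤ C ^ (2 / q) * lqNormUnit (ENNReal.ofReal q) f) :
    lqNormUnit (ENNReal.ofReal p) f ≤
      C ^ (2 / q - 2 / p) * lqNormUnit (ENNReal.ofReal q) f := by
  have hp : 0 < p := hq.trans hqp
  have hpq : 0 ≤ p - q := sub_nonneg.2 hqp.le
  set K := lqNormUnit (ENNReal.ofReal q) f with hK
  refine (ENNReal.rpow_le_rpow_iff hp).1 ?_
  calc lqNormUnit (ENNReal.ofReal p) f ^ p
      ≤ supNormOn (Set.Icc 0 1) f ^ (p - q) * K ^ q := lqNormUnit_rpow_le hq hqp.le hf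
    _ ≤ (C ^ (2 / q) * K) ^ (p - q) * K ^ q := by gcongr
    _ = C ^ (2 / q * (p - q)) * (K ^ (p - q) * K ^ q) := by
        rw [ENNReal.mul_rpow_of_nonneg _ _ hpq, ENNReal.rpow_mul, mul_assoc]
    _ = C ^ ((2 / q - 2 / p) * p) * K ^ p := by
        rw [← ENNReal.rpow_add_of_nonneg _ _ hpq hq.le, sub_add_cancel]
        congr 2
        field_simp
    _ = _ := by rw [ENNReal.mul_rpow_of_nonneg _ _ hp.le, ENNReal.rpow_mul]

theorem theorem2p3 (n : ℕ) (f : ℝ → ℂ) (hf : f ∈ ExpSums n) :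
    (supNormOn (Set.Icc (0 : ℝ) 1) f ≤
      ENNReal.ofReal (Real.pi * (n : ℝ) / 2) * lqNormUnit 2 f) ∧
    (∀ q : ℝ, 0 < q → q ≤ 2 →
      supNormOn (Set.Icc (0 : ℝ) 1) f ≤
        ENNReal.ofReal ((Real.pi * (n : ℝ) / 2) ^ (2 / q)) *
          lqNormUnit (ENNReal.ofReal q) f) ∧
    (∀ p q : ℝ, 0 < q → q < p → q ≤ 2 →
      lqNormUnit (ENNReal.ofReal p) f ≤
        ENNReal.ofReal ((Real.pi * (n : ℝ) / 2) ^ (2 / q - 2 / p)) *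
          lqNormUnit (ENNReal.ofReal q) f) ∧
    (∀ q : ℝ, 0 < q → q ≤ 2 →
      lqNormUnit ∞ f ≤
        ENNReal.ofReal ((Real.pi * (n : ℝ) / 2) ^ (2 / q)) *
          lqNormUnit (ENNReal.ofReal q) f) := by
  obtain ⟨a, lam, -, hf⟩ := hf
  have hcont := continuous_expSum a lam hf
  have hc : 0 ≤ Real.pi * (n : ℝ) / 2 := by positivity
  have h2 := supNormOn_le_lqNormUnit_two a lam hf
  have hsup : ∀ q : ℝ, 0 < q → q ≤ 2 → supNormOn (Set.Icc (0 : ℝ) 1) f ≤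
      ENNReal.ofReal ((Real.pi * (n : ℝ) / 2) ^ (2 / q)) * lqNormUnit (ENNReal.ofReal q) f := by
    intro q hq hq2
    rw [← ENNReal.ofReal_rpow_of_nonneg hc (by positivity)]
    exact supNormOn_le_of_le_two hcont h2 hq hq2
  refine ⟨by simpa using h2, hsup, fun p q hq hqp hq2 => ?_,
    fun q hq hq2 => (lqNormUnit_top_le_supNormOn f).trans (hsup q hq hq2)⟩
  rw [← ENNReal.ofReal_rpow_of_nonneg hc
    (sub_nonneg.2 (div_le_div_of_nonneg_left zero_le_two hq hqp.le))]
  exact lqNormUnit_le_of_supNormOn_le hcont hq hqp (supNormOn_le_of_le_two hcont h2 hq hq2)
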